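/- Let $G$ be a countable group and let $\nu$ be a probability measure on $G$ that is non-degenerate, i.e. the support of $\nu$ generates $G$ as a semigroup (for instance, $\nu$ has full support). Let $(X_n)_{n\ge 1}$ be i.i.d. with law $\nu$ and let $z_n = X_1\cdots X_n$; "almost every trajectory" refers to the law $P$ of $\zeta=(z_1,z_2,\ldots)$ on $\Omega = G^{\mathbb N}$, $\mathbb N=\{1,2,\ldots\}$. The Poisson boundary $\partial(G,\nu)$ is the space of ergodic components of the time shift on $(\Omega,P)$, i.e. the ($G$-equivariant, standard Borel) factor of $(\Omega,P)$ corresponding mod $0$ to the $\sigma$-algebra of shift-invariant measurable sets, where $G$ acts on $\Omega$ by $g\cdot(z_1,z_2,\ldots)=(gz_1,gz_2,\ldots)$. It is trivial if every shift-invariant measurable set has $P$-measure $0$ or $1$. The action on the boundary is essentially free if for every $g\neq 1$ the set of points of the boundary fixed by $g$ is null for the image of $P$. Let $W'_i\subset W_i\subset G$, $i\in\mathbb N$, with $W_i\cap W_j=\varnothing$ for $i\ne j$. For $g\in G$ let $\operatorname{rank}(g)=i$ if $g\in W_i$, and $\operatorname{rank}(g)=0$ if $g\notin\bigcup_i W_i$.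 Let $p:\bigcup_{i} W_i\to G$ be a function such that 1. $\operatorname{rank}(p(g))<\operatorname{rank}(g)$ for every $g\in\bigcup_i W_i$; 2. for every $h\in G$ there is $N$ such that for all $i>N$ and all $w\in W'_i$ one has $hw\in W_i$ and $p(hw)=h\,p(w)$; 3. for almost every trajectory $(z_1,z_2,\ldots)$ there is $i_0$ such that for all $i>i_0$ there is $j$ with $z_i\in W'_j$; 4. for almost every trajectory $(z_1,z_2,\ldots)$ there is $i_0$ such that for all $i>i_0$ either $p(z_{i+1})=p(z_i)$ or $p(z_{i+1})=z_i$; 5. for almost every trajectory the sequence $\operatorname{rank}(z_i)$ is unbounded. Then the Poisson boundary $\partial(G,\nu)$ is non-trivial, and the action of $G$ on it is essentially free. -/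

import Mathlib

open MeasureTheory ProbabilityTheory

universe u

namespace GroupWalk

/-- The trajectory `(z₁, z₂, …)` with `zₙ = x₁ ⋯ xₙ` of the increments `(x₁, x₂, …)`. Sequences are
indexed by `ℕ`, so that `x i` stands for `xᵢ₊₁` and `trajectory x i` for `zᵢ₊₁`. -/
def trajectory {G : Type*} [Group G] (x : ℕ → G) : ℕ → G
  | 0 => x 0
  | n + 1 => trajectory x n * x (n + 1)

/-- The law of the trajectory of the `ν`-random walk: the image of the law of the i.i.d. increments
on the space of trajectories `ℕ → G`. -/
noncomputable def pathLaw {G : Type*} [Group G] [MeasurableSpace G] (ν : Measure G)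
    [IsProbabilityMeasure ν] : Measure (ℕ → G) :=
  (Measure.infinitePi fun _ : ℕ => ν).map trajectory

/-- The time shift `(z₁, z₂, …) ↦ (z₂, z₃, …)`. -/
def shift {G : Type*} (z : ℕ → G) : ℕ → G := fun n => z (n + 1)

/-- The measure `ν` is non-degenerate: its support generates `G` as a semigroup. -/
def NonDegenerate {G : Type*} [Group G] [MeasurableSpace G] (ν : Measure G) : Prop :=
  Subsemigroup.closure {g : G | ν {g} ≠ 0} = ⊤

/-- The σ-algebra of shift-invariant measurable sets of trajectories is trivial mod `0`. -/
def TrivialBoundary {G : Type*} [Group G] [MeasurableSpace G] (ν : Measure G)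
    [IsProbabilityMeasure ν] : Prop :=
  ∀ A : Set (ℕ → G), MeasurableSet[MeasurableSpace.invariants shift] A →
    pathLaw ν A = 0 ∨ pathLaw ν A = 1

/-- `bnd : (ℕ → G) → B` exhibits the standard Borel `G`-space `B`, with the measure
`(pathLaw ν).map bnd`, as the Poisson boundary of the `ν`-random walk, that is, as the space of
ergodic components of the shift: the `G`-equivariant factor of the space of trajectories that
corresponds mod `0` to the σ-algebra of shift-invariant sets. The action on trajectories is
`(g • z) n = g * z n`. -/
structure IsPoissonBoundary {G : Type*} [Group G] [MeasurableSpace G] (ν : Measure G)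
    [IsProbabilityMeasure ν] {B : Type*} [MeasurableSpace B] [StandardBorelSpace B] [MulAction G B]
    (bnd : (ℕ → G) → B) : Prop where
  measurable_smul : ∀ g : G, Measurable fun b : B => g • b
  measurable_bnd : Measurable[MeasurableSpace.invariants shift] bnd
  equivariant : ∀ g : G, ∀ᵐ z ∂pathLaw ν, bnd (g • z) = g • bnd z
  generates : ∀ A : Set (ℕ → G), MeasurableSet[MeasurableSpace.invariants shift] A →
    ∃ S : Set B, MeasurableSet S ∧ A =ᵐ[pathLaw ν] bnd ⁻¹' S

/-- The action of `G` on `(B, m)` is essentially free. -/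
def EssentiallyFree (G : Type*) [Group G] {B : Type*} [MeasurableSpace B] [MulAction G B]
    (m : Measure B) : Prop :=
  ∀ g : G, g ≠ 1 → m {b : B | g • b = b} = 0

open Classical in
/-- `rank W g` is `i` if `g ∈ W i` (the sets `W i`, `i ≥ 1`, being disjoint), and `0` if `g` is in
none of them. -/
noncomputable def rank {G : Type*} (W : ℕ+ → Set G) (g : G) : ℕ :=
  if h : ∃ i, g ∈ W i then (h.choose : ℕ) else 0

theorem measurable_trajectory {G : Type*} [Group G] [MeasurableSpace G] [Countable G]
    [MeasurableSingletonClass G] : Measurable (trajectory : (ℕ → G) → ℕ → G) := by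
  refine measurable_pi_lambda _ fun n => ?_
  induction n with
  | zero => exact measurable_pi_apply 0
  | succ n ih => exact ih.mul (measurable_pi_apply (n + 1))

theorem isProbabilityMeasure_pathLaw {G : Type*} [Group G] [MeasurableSpace G] [Countable G]
    [MeasurableSingletonClass G] (ν : Measure G) [IsProbabilityMeasure ν] :
    IsProbabilityMeasure (pathLaw ν) :=
  Measure.isProbabilityMeasure_map measurable_trajectory.aemeasurable

/-- The Poisson boundary exists. -/
theorem exists_isPoissonBoundary {G : Type u} [Group G] [MeasurableSpace G] [Countable G]
    [MeasurableSingletonClass G] (ν : Measure G) [IsProbabilityMeasure ν] :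
    ∃ (B : Type u) (_ : MeasurableSpace B) (_ : StandardBorelSpace B) (_ : MulAction G B)
      (bnd : (ℕ → G) → B), IsPoissonBoundary ν bnd := by
  have hP := isProbabilityMeasure_pathLaw ν
  have hI : MeasurableSpace.invariants (shift : (ℕ → G) → ℕ → G) ≤ MeasurableSpace.pi :=
    MeasurableSpace.invariants_le _
  let κ : (ℕ → G) → Measure (ℕ → G) := fun z =>
    condExpKernel (pathLaw ν) (MeasurableSpace.invariants shift) z
  have hκp : ∀ z, IsProbabilityMeasure (κ z) := fun z => inferInstance
  have hκm : ∀ A, MeasurableSet A →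
      Measurable[MeasurableSpace.invariants shift] fun z => κ z A :=
    fun A hA => measurable_condExpKernel hA
  obtain ⟨e, he⟩ := exists_measurableEmbedding_real (ℕ → G)
  let C : ℚ → Set (ℕ → G) := fun q => e ⁻¹' Set.Iic (q : ℝ)
  have hC : ∀ q, MeasurableSet (C q) := fun q => he.measurable measurableSet_Iic
  let act : MulAction G (G → ℚ → ENNReal) :=
    { smul := fun g f x => f (x * g)
      one_smul := fun f => by
        funext x; change f (x * 1) = f x; rw [mul_one]
      mul_smul := fun g h f => by
        funext x; change f (x * (g * h)) = f (x * g * h); rw [mul_assoc] }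
  let bnd : (ℕ → G) → G → ℚ → ENNReal := fun z x q => κ (x • z) (C q)
  have hbnd : Measurable[MeasurableSpace.invariants shift] bnd := by
    refine @measurable_pi_lambda _ _ _ (MeasurableSpace.invariants shift) _ _ fun x =>
      @measurable_pi_lambda _ _ _ (MeasurableSpace.invariants shift) _ _ fun q => ?_
    intro S hS
    have h := hκm (C q) (hC q) hS
    rw [MeasurableSpace.measurableSet_invariants] at h ⊢
    have hx : Measurable fun z : ℕ → G => x • z :=
        measurable_pi_lambda _ fun n =>
        (measurable_const_mul x).comp (measurable_pi_apply n)
    refine ⟨hx h.1, ?_⟩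
    ext z
    exact Set.ext_iff.1 h.2 (x • z)
  refine ⟨G → ℚ → ENNReal, inferInstance, inferInstance, act, bnd, ?_, hbnd, ?_, ?_⟩
  · intro g
    exact measurable_pi_lambda _ fun x => measurable_pi_apply (x * g)
  · intro g
    refine Filter.Eventually.of_forall fun z => ?_
    funext x q
    change κ (x • g • z) (C q) = κ ((x * g) • z) (C q)
    rw [smul_smul]
  · intro A hA
    have hgen : (MeasurableSpace.pi : MeasurableSpace (ℕ → G)) =
        MeasurableSpace.generateFrom (Set.range C) := by
      rw [← he.comap_eq, BorelSpace.measurable_eq (α := ℝ), Real.borel_eq_generateFrom_Iic_rat,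
        MeasurableSpace.comap_generateFrom]
      congr 1
      ext s
      simp [C]
    have hpi : IsPiSystem (Set.range C) := by
      rintro _ ⟨a, rfl⟩ _ ⟨b, rfl⟩ -
      refine ⟨min a b, ?_⟩
      ext z
      simp [C]
    have hκJ : Measurable[MeasurableSpace.comap bnd inferInstance] κ := by
      refine @Measurable.measure_of_isPiSystem_of_isProbabilityMeasure _ _
        (MeasurableSpace.comap bnd inferInstance) _ κ hκp _ hgen hpi ?_
      rintro _ ⟨q, rfl⟩
      have h1 : Measurable fun f : G → ℚ → ENNReal => f 1 q :=
        (measurable_pi_apply q).comp (measurable_pi_apply 1)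
      have h2 : (fun z => κ z (C q)) = (fun f : G → ℚ → ENNReal => f 1 q) ∘ bnd := by
        funext z
        simp [bnd]
      rw [h2]
      exact h1.comp (comap_measurable bnd)
    have hS : MeasurableSet[MeasurableSpace.comap bnd inferInstance] {z | κ z A = 1} :=
      ((Measure.measurable_coe (hI A hA)).comp hκJ) (measurableSet_singleton 1)
    obtain ⟨S, hSm, hSe⟩ := hS
    refine ⟨S, hSm, ?_⟩
    rw [hSe]
    have h3 := condExpKernel_ae_eq_condExp (μ := pathLaw ν) hI (hI A hA)
    rw [condExp_of_stronglyMeasurable hI (stronglyMeasurable_const.indicator hA)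
      ((integrable_const (1 : ℝ)).indicator (hI A hA))] at h3
    filter_upwards [h3] with z hz
    have hz' : (κ z).real A = A.indicator (fun _ => (1 : ℝ)) z := hz
    change (z ∈ A) = (κ z A = 1)
    by_cases hzA : z ∈ A
    · rw [Set.indicator_of_mem hzA, measureReal_def, ENNReal.toReal_eq_one_iff] at hz'
      simp [hzA, hz']
    · rw [Set.indicator_of_notMem hzA, measureReal_def] at hz'
      have : κ z A ≠ 1 := fun h => by simp [h] at hz'
      simp [hzA, this]

end GroupWalk

/-!
# Boundaries of random walks from ranked forests

The map `p` makes `G` into a forest in which every element of positive rank has a parent of smaller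
rank. A typical trajectory eventually moves only to siblings and children, so that the parents of
its points move away from the root along a ray. Left translations commute with `p` far from the
root, hence the end of the forest reached by the trajectory is an equivariant, shift-invariant
function of the trajectory. The end is encoded by the set `limitRay` of the elements that are
eventually ancestors of the points of the trajectory. Both claims follow from
`ae_limitRay_smul_ne`: for almost every trajectory `z`, every `g ≠ 1` changes this set. Indeed the
events `a ∈ limitRay W p z` are shift-invariant, so the set is determined by the boundary point of
`z`, and it is almost surely constant if the boundary is trivial.

The parents of the points of the trajectory do run to an end (`ae_parent_not_eventually_const`):
the law of an eventually constant parent would be a stationary finite measure on the infinite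
group `G`, and the maximum principle excludes it.

Suppose that `g ≠ 1` preserves the ray of `z`. Since `g` has no fixed points, it acts far from
the root as a translation of the ray, and one may assume, passing to `g⁻¹` and `g • z` if
necessary, that `g` moves points towards the root. Then the ray is covered by finitely many orbits
of `g`, and `(z i)⁻¹ * g * z i`, which is constant along an orbit, takes some value `c` for
infinitely many `i`. As the support of `ν` generates `G` as a semigroup, a conditional
Borel-Cantelli argument (`ae_frequently_and_trajectory_add_eq`) gives a length `l` such that
infinitely often at such times the next `l` increments have product `c`, that is,
`z (i + l) = g * z i`. But the parent of `g * z i` has smaller rank than that of `z i`, whereas the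
rank of the parent does not decrease along the trajectory
(`IsGoodPath.not_eventually_rank_mul_lt`).

Statements about one trajectory and its translates are combined by `ae_forall_smul`: a
shift-invariant property of almost every trajectory holds for all translates of almost every one.
-/

namespace GroupWalk

open Filter Relation

/-! ### Ranked forests and the paths in them -/

/-- The edges of the forest on `G` defined by `p`: every element `b` of positive rank is joined to
its parent `p b`. The values of `p` on elements of rank `0` are ignored. -/
def IsParent {G : Type*} (W : ℕ+ → Set G) (p : G → G) (b a : G) : Prop :=
  b ∈ ⋃ i, W i ∧ p b = a

/-- The ancestor relation of the forest: `a` is `b` or is reached from `b` by passing to parents. -/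
abbrev IsAncestor {G : Type*} (W : ℕ+ → Set G) (p : G → G) : G → G → Prop :=
  ReflTransGen (IsParent W p)

/-- The elements that are eventually ancestors of the points of the path `z`. For a path that runs
to an end of the forest, this is the geodesic ray from the root to that end. -/
def limitRay {G : Type*} (W : ℕ+ → Set G) (p : G → G) (z : ℕ → G) : Set G :=
  {a | ∀ᶠ i in atTop, IsAncestor W p (z i) a}

/-- The properties of almost every trajectory that are used to compare the limits of `z` and of its
translates. All of them are invariant under the shift. The condition `returns` says that if the
right increment `c` that takes `z i` to `h * z i` is the same for infinitely many `i`, then the path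
infinitely often makes this move, in a fixed number `l` of steps. -/
structure IsGoodPath {G : Type*} [Group G] (W W' : ℕ+ → Set G) (p : G → G) (z : ℕ → G) : Prop where
  mem : ∀ᶠ i in atTop, ∃ j, z i ∈ W' j
  step : ∀ᶠ i in atTop, p (z (i + 1)) = p (z i) ∨ p (z (i + 1)) = z i
  parent_not_eventually_const : ∀ q, ¬ ∀ᶠ i in atTop, p (z i) = q
  returns : ∀ h c, (∃ᶠ i in atTop, (z i)⁻¹ * h * z i = c) →
    ∃ l, ∃ᶠ i in atTop, z (i + l) = h * z i

variable {G : Type*} {W W' : ℕ+ → Set G} {p : G → G} {z : ℕ → G}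

theorem rank_eq_of_mem (hW : ∀ i j, i ≠ j → W i ∩ W j = ∅) {g : G} {i : ℕ+} (hg : g ∈ W i) :
    rank W g = i := by
  have h : ∃ i, g ∈ W i := ⟨i, hg⟩
  rw [rank, dif_pos h]
  congr 1
  by_contra hne
  have : g ∈ W h.choose ∩ W i := ⟨h.choose_spec, hg⟩
  rw [hW _ _ hne] at this
  exact this

section Forest

variable (h1 : ∀ g ∈ ⋃ i, W i, rank W (p g) < rank W g)
include h1

theorem IsAncestor.eq_or_rank_lt {a b : G} (h : IsAncestor W p b a) :
    b = a ∨ rank W a < rank W b := by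
  induction h with
  | refl => exact Or.inl rfl
  | tail _ hbc ih =>
    obtain ⟨hb, rfl⟩ := hbc
    right
    rcases ih with rfl | ih
    · exact h1 _ hb
    · exact (h1 _ hb).trans ih

theorem IsAncestor.rank_le {a b : G} (h : IsAncestor W p b a) : rank W a ≤ rank W b := by
  rcases IsAncestor.eq_or_rank_lt h1 h with rfl | h
  · exact le_rfl
  · exact h.le

omit h1 in
theorem IsAncestor.eq_or_parent {a b : G} (h : IsAncestor W p b a) :
    b = a ∨ b ∈ ⋃ i, W i ∧ IsAncestor W p (p b) a := by
  rcases ReflTransGen.cases_head h with h | ⟨c, ⟨hb, rfl⟩, hc⟩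
  · exact Or.inl h
  · exact Or.inr ⟨hb, hc⟩

theorem finite_setOf_isAncestor (b : G) : {a | IsAncestor W p b a}.Finite := by
  induction hn : rank W b using Nat.strong_induction_on generalizing b with
  | _ n ih =>
    by_cases hb : b ∈ ⋃ i, W i
    · refine ((ih _ (hn ▸ h1 b hb) (p b) rfl).insert b).subset fun a ha => ?_
      rcases IsAncestor.eq_or_parent ha with h | h
      · exact Or.inl h.symm
      · exact Or.inr h.2
    · refine (Set.finite_singleton b).subset fun a ha => ?_
      rcases IsAncestor.eq_or_parent ha with h | h
      · exact h.symm
      · exact absurd h.1 hb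

omit h1 in
/-- A limit ray is a chain: any two of its elements are ancestors of a common point, and parents
are unique. -/
theorem isAncestor_total_of_mem_limitRay {a b : G} (ha : a ∈ limitRay W p z)
    (hb : b ∈ limitRay W p z) : IsAncestor W p a b ∨ IsAncestor W p b a := by
  obtain ⟨i, hia, hib⟩ := (ha.and hb).exists
  exact ReflTransGen.total_of_right_unique (fun _ _ _ hx hy => hx.2.symm.trans hy.2) hia hib

end Forest

/-- From the time `n` on, the path `z` stays in `⋃ j, W' j` and moves to a sibling or to a child. -/
def IsRegularFrom (W' : ℕ+ → Set G) (p : G → G) (z : ℕ → G) (n : ℕ) : Prop :=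
  ∀ i ≥ n, (∃ j, z i ∈ W' j) ∧ (p (z (i + 1)) = p (z i) ∨ p (z (i + 1)) = z i)

namespace IsRegularFrom

variable {n : ℕ} (hz : IsRegularFrom W' p z n) (hW' : ∀ i, W' i ⊆ W i)
include hz hW'

theorem mem_iUnion {i : ℕ} (hi : n ≤ i) : z i ∈ ⋃ j, W j := by
  obtain ⟨j, hj⟩ := (hz i hi).1
  exact Set.mem_iUnion.2 ⟨j, hW' j hj⟩

theorem isAncestor_parent {i j : ℕ} (hi : n ≤ i) (hij : i ≤ j) :
    IsAncestor W p (p (z j)) (p (z i)) := by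
  induction j, hij using Nat.le_induction with
  | base => exact ReflTransGen.refl
  | succ j hij ih =>
    rcases (hz j (hi.trans hij)).2 with h | h
    · rwa [h]
    · rw [h]
      exact ReflTransGen.head ⟨hz.mem_iUnion hW' (hi.trans hij), rfl⟩ ih

theorem parent_mem_limitRay {i : ℕ} (hi : n ≤ i) : p (z i) ∈ limitRay W p z := by
  filter_upwards [eventually_ge_atTop i] with j hj
  exact ReflTransGen.head ⟨hz.mem_iUnion hW' (hi.trans hj), rfl⟩ (hz.isAncestor_parent hW' hi hj)

variable (h1 : ∀ g ∈ ⋃ i, W i, rank W (p g) < rank W g)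
include h1

theorem rank_parent_le {i j : ℕ} (hi : n ≤ i) (hij : i ≤ j) :
    rank W (p (z i)) ≤ rank W (p (z j)) :=
  IsAncestor.rank_le h1 (hz.isAncestor_parent hW' hi hij)

/-- Along a path that moves to siblings and children, the parent either is eventually constant or
runs to an end of the forest. -/
theorem tendsto_rank_parent (hc : ∀ q, ¬ ∀ᶠ i in atTop, p (z i) = q) :
    Tendsto (fun i => rank W (p (z i))) atTop atTop := by
  refine tendsto_atTop.2 fun N => ?_
  have key : ∃ j ≥ n, N ≤ rank W (p (z j)) := by
    induction N with
    | zero => exact ⟨n, le_rfl, Nat.zero_le _⟩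
    | succ N ih =>
      obtain ⟨j, hj, hN⟩ := ih
      obtain ⟨k, hk, hne⟩ : ∃ k ≥ j, p (z k) ≠ p (z j) := by
        by_contra! h
        exact hc (p (z j)) (eventually_atTop.2 ⟨j, h⟩)
      refine ⟨k, hj.trans hk, ?_⟩
      have := (IsAncestor.eq_or_rank_lt h1 (hz.isAncestor_parent hW' hj hk)).resolve_left hne
      omega
  obtain ⟨j, hj, hN⟩ := key
  filter_upwards [eventually_ge_atTop j] with i hi
  exact hN.trans (hz.rank_parent_le hW' h1 hj hi)

/-- The parents of the points of the path exhaust the part of its limit ray beyond the first of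
them. -/
theorem exists_eq_parent (hc : ∀ q, ¬ ∀ᶠ i in atTop, p (z i) = q) {a : G}
    (ha : a ∈ limitRay W p z) {i : ℕ} (hi : n ≤ i) (hai : IsAncestor W p a (p (z i))) :
    ∃ k ≥ i, a = p (z k) := by
  have hj : ∀ j ≥ i, IsAncestor W p (p (z j)) a → ∃ k ≥ i, a = p (z k) := by
    intro j hij
    induction j, hij using Nat.le_induction with
    | base =>
      intro h
      refine ⟨i, le_rfl, ?_⟩
      rcases IsAncestor.eq_or_rank_lt h1 h with h | h
      · exact h.symm
      · exact absurd (IsAncestor.rank_le h1 hai) (not_le.2 h)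
    | succ j hij ih =>
      intro h
      rcases (hz j (hi.trans hij)).2 with hs | hs
      · exact ih (hs ▸ h)
      · rcases IsAncestor.eq_or_parent h with h | h
        · exact ⟨j + 1, hij.trans (Nat.le_succ j), h.symm⟩
        · exact ih (hs ▸ h.2)
  obtain ⟨j, hja, hji, hjr⟩ := (ha.and ((eventually_ge_atTop i).and
    ((hz.tendsto_rank_parent hW' h1 hc).eventually_gt_atTop (rank W a)))).exists
  refine hj j hji ?_
  rcases IsAncestor.eq_or_parent hja with h | h
  · have := h1 _ (hz.mem_iUnion hW' (hi.trans hji))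
    rw [h] at this
    rw [h] at hjr
    omega
  · exact h.2

end IsRegularFrom

/-! ### Translates of paths -/

section Translate

variable [Group G]

theorem IsGoodPath.exists_isRegularFrom (hz : IsGoodPath W W' p z) :
    ∃ n, IsRegularFrom W' p z n :=
  eventually_atTop.1 (hz.mem.and hz.step)

theorem IsGoodPath.eventually_parent_mul (hz : IsGoodPath W W' p z)
    (hW' : ∀ i, W' i ⊆ W i) (hW : ∀ i j, i ≠ j → W i ∩ W j = ∅)
    (h1 : ∀ g ∈ ⋃ i, W i, rank W (p g) < rank W g)
    (h2 : ∀ h : G, ∃ N : ℕ+, ∀ i > N, ∀ w ∈ W' i, h * w ∈ W i ∧ p (h * w) = h * p w) (h : G) :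
    ∀ᶠ i in atTop, p (h * z i) = h * p (z i) := by
  obtain ⟨n, hn⟩ := hz.exists_isRegularFrom
  obtain ⟨N, hN⟩ := h2 h
  filter_upwards [hz.mem, eventually_ge_atTop n, (hn.tendsto_rank_parent hW' h1
    hz.parent_not_eventually_const).eventually_ge_atTop (N : ℕ)] with i ⟨j, hj⟩ hi hr
  refine (hN j ?_ _ hj).2
  have := h1 _ (hn.mem_iUnion hW' hi)
  rw [rank_eq_of_mem hW (hW' j hj)] at this
  exact PNat.coe_lt_coe _ _ |>.1 (hr.trans_lt this)

/-- A translation that preserves the limit ray of a good path cannot move its points towards the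
root. Indeed the ray would be covered by finitely many orbits of `h`, so that `(z i)⁻¹ * h * z i`
would take some value infinitely often, and the path would infinitely often pass from `z i` to
`h * z i`, whose parent is closer to the root than that of `z i`. -/
theorem IsGoodPath.not_eventually_rank_mul_lt (hz : IsGoodPath W W' p z) {h : G}
    (hhz : IsGoodPath W W' p (h • z)) (hray : limitRay W p z = limitRay W p (h • z))
    (hW' : ∀ i, W' i ⊆ W i) (hW : ∀ i j, i ≠ j → W i ∩ W j = ∅)
    (h1 : ∀ g ∈ ⋃ i, W i, rank W (p g) < rank W g)
    (h2 : ∀ h : G, ∃ N : ℕ+, ∀ i > N, ∀ w ∈ W' i, h * w ∈ W i ∧ p (h * w) = h * p w) :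
    ¬ ∀ᶠ i in atTop, rank W (h * p (z i)) < rank W (p (z i)) := by
  intro hlt
  obtain ⟨n, hn⟩ := hz.exists_isRegularFrom
  obtain ⟨n', hn'⟩ := hhz.exists_isRegularFrom
  obtain ⟨m, hm⟩ := eventually_atTop.1 (hlt.and ((hz.eventually_parent_mul hW' hW h1 h2 h).and
    ((eventually_ge_atTop n).and (eventually_ge_atTop n'))))
  have hconj : ∀ a ∈ limitRay W p z,
      ∃ f ∈ {f | IsAncestor W p (p (z m)) f}, a⁻¹ * h * a = f⁻¹ * h * f := by
    intro a
    induction hr : rank W a using Nat.strong_induction_on generalizing a with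
    | _ r ih =>
      intro ha
      obtain ⟨-, -, hmn, -⟩ := hm m le_rfl
      rcases isAncestor_total_of_mem_limitRay ha (hn.parent_mem_limitRay hW' hmn) with hc | hc
      · obtain ⟨k, hk, rfl⟩ := hn.exists_eq_parent hW' h1 hz.parent_not_eventually_const ha hmn hc
        obtain ⟨hk1, hk2, -, hk3⟩ := hm k hk
        have hmem : h * p (z k) ∈ limitRay W p z := by
          rw [hray, ← hk2]
          exact hn'.parent_mem_limitRay hW' hk3
        obtain ⟨f, hf, hfe⟩ := ih _ (hr ▸ hk1) _ rfl hmem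
        exact ⟨f, hf, by rw [← hfe]; group⟩
      · exact ⟨a, hc, rfl⟩
  -- The parent changes infinitely often, and it changes to a point of the path.
  have hfreq : ∃ᶠ i in atTop, p (z (i + 1)) = z i := by
    intro hnot
    obtain ⟨k, hk⟩ := eventually_atTop.1 (hnot.and hz.step)
    refine hz.parent_not_eventually_const (p (z k)) (eventually_atTop.2 ⟨k, fun i hi => ?_⟩)
    induction i, hi using Nat.le_induction with
    | base => rfl
    | succ i hi ih => exact ((hk i hi).2.resolve_right (hk i hi).1).trans ih
  obtain ⟨c, hc⟩ : ∃ c, ∃ᶠ i in atTop, (z i)⁻¹ * h * z i = c := by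
    by_contra! hcon
    have hev := ((finite_setOf_isAncestor h1 (p (z m))).eventually_all (l := atTop)
      (p := fun f i => (z i)⁻¹ * h * z i ≠ f⁻¹ * h * f)).2
      fun f _ => hcon (f⁻¹ * h * f)
    obtain ⟨i, hi, hi2, hin⟩ := (hfreq.and_eventually (hev.and (eventually_ge_atTop n))).exists
    obtain ⟨f, hf, hfe⟩ := hconj _ (hn.parent_mem_limitRay hW' (hin.trans (Nat.le_succ i)))
    rw [hi] at hfe
    exact hi2 f hf hfe
  obtain ⟨l, hl⟩ := hz.returns h c hc
  obtain ⟨i, hil, him⟩ := (hl.and_eventually (eventually_ge_atTop m)).exists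
  obtain ⟨hi1, hi2, hi3, -⟩ := hm i him
  have := hn.rank_parent_le hW' h1 hi3 (Nat.le_add_right i l)
  rw [hil, hi2] at this
  omega

/-- The ends of good paths have trivial stabilizers: an element `g ≠ 1` that preserves the limit ray
has no fixed point in it, so that `g` or `g⁻¹` would move its far points towards the root. -/
theorem IsGoodPath.eq_one_of_limitRay_smul_eq (hz : IsGoodPath W W' p z) {g : G}
    (hgz : IsGoodPath W W' p (g • z)) (hray : limitRay W p z = limitRay W p (g • z))
    (hW' : ∀ i, W' i ⊆ W i) (hW : ∀ i j, i ≠ j → W i ∩ W j = ∅)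
    (h1 : ∀ g ∈ ⋃ i, W i, rank W (p g) < rank W g)
    (h2 : ∀ h : G, ∃ N : ℕ+, ∀ i > N, ∀ w ∈ W' i, h * w ∈ W i ∧ p (h * w) = h * p w) :
    g = 1 := by
  by_contra hg
  obtain ⟨n, hn⟩ := hz.exists_isRegularFrom
  obtain ⟨n', hn'⟩ := hgz.exists_isRegularFrom
  obtain ⟨m, hm⟩ := eventually_atTop.1 ((hz.eventually_parent_mul hW' hW h1 h2 g).and
    ((eventually_ge_atTop n).and (eventually_ge_atTop n')))
  have hmem : ∀ i ≥ m, g * p (z i) ∈ limitRay W p z := by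
    intro i hi
    obtain ⟨hi1, -, hi2⟩ := hm i hi
    rw [hray, ← hi1]
    exact hn'.parent_mem_limitRay hW' hi2
  have htri : ∀ i ≥ m, rank W (g * p (z i)) < rank W (p (z i)) ∨
      (IsAncestor W p (g * p (z i)) (p (z i)) ∧ rank W (p (z i)) < rank W (g * p (z i))) := by
    intro i hi
    have hne : g * p (z i) ≠ p (z i) := fun h => hg (mul_eq_right.1 h)
    rcases isAncestor_total_of_mem_limitRay (hmem i hi)
      (hn.parent_mem_limitRay hW' (hm i hi).2.1) with h | h
    · exact Or.inr ⟨h, (IsAncestor.eq_or_rank_lt h1 h).resolve_left hne⟩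
    · exact Or.inl ((IsAncestor.eq_or_rank_lt h1 h).resolve_left hne.symm)
  by_cases hex : ∃ k ≥ m, rank W (g * p (z k)) < rank W (p (z k))
  · -- Once `g` moves a parent towards the root, it does so with all later ones.
    obtain ⟨k, hkm, hk⟩ := hex
    refine hz.not_eventually_rank_mul_lt hgz hray hW' hW h1 h2
      (eventually_atTop.2 ⟨k, fun i hi => ?_⟩)
    induction i, hi using Nat.le_induction with
    | base => exact hk
    | succ i hi ih =>
      have him : m ≤ i := hkm.trans hi
      obtain ⟨hi1, hi2, -⟩ := hm i him
      rcases (hn i hi2).2 with hs | hs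
      · rwa [hs]
      · refine (htri (i + 1) (him.trans (Nat.le_succ i))).resolve_right fun ⟨hanc, hlt⟩ => ?_
        rw [hs] at hanc hlt
        rcases IsAncestor.eq_or_parent hanc with h | h
        · exact hg (mul_eq_right.1 h)
        · have h3 := IsAncestor.rank_le h1 h.2
          rw [hi1] at h3
          have h4 := h1 _ (hn.mem_iUnion hW' hi2)
          omega
  · -- Otherwise `g⁻¹` moves the parents of the path `g • z` towards the root.
    have hinv : g⁻¹ • g • z = z := inv_smul_smul g z
    refine hgz.not_eventually_rank_mul_lt (h := g⁻¹) (by rwa [hinv]) (by rw [hinv, hray])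
      hW' hW h1 h2 (eventually_atTop.2 ⟨m, fun i hi => ?_⟩)
    have hi1 : p ((g • z) i) = g * p (z i) := (hm i hi).1
    rw [hi1, inv_mul_cancel_left]
    exact ((htri i hi).resolve_left fun h => hex ⟨i, hi, h⟩).2

end Translate

/-! ### The Markov property and quasi-invariance of shift-invariant events -/

section Markov

variable {G : Type*} [Group G]

/-- The trajectory with first increment `x` whose later increments are those of the
trajectory `z`. -/
def prepend (x : G) (z : ℕ → G) : ℕ → G
  | 0 => x
  | n + 1 => x * z n

theorem shift_prepend (x : G) (z : ℕ → G) : shift (prepend x z) = x • z := rfl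

/-- The sequence with first term `x` and later terms `y`. -/
def consSeq {G : Type*} (x : G) (y : ℕ → G) : ℕ → G
  | 0 => x
  | n + 1 => y n

theorem trajectory_consSeq (x : G) (y : ℕ → G) :
    trajectory (consSeq x y) = prepend x (trajectory y) := by
  funext n
  induction n with
  | zero => rfl
  | succ n ih =>
    change trajectory (consSeq x y) n * y n = x * trajectory y n
    rw [ih]
    cases n with
    | zero => rfl
    | succ n => exact mul_assoc _ _ _

variable [MeasurableSpace G]

omit [Group G] in
theorem measurable_consSeq : Measurable fun q : G × (ℕ → G) => consSeq q.1 q.2 := by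
  refine measurable_pi_lambda _ fun n => ?_
  cases n with
  | zero => exact measurable_fst
  | succ n => exact (measurable_pi_apply n).comp measurable_snd

omit [Group G] in
theorem map_consSeq_prod_infinitePi (ν : Measure G) [IsProbabilityMeasure ν] :
    (ν.prod (Measure.infinitePi fun _ : ℕ => ν)).map (fun q => consSeq q.1 q.2) =
      Measure.infinitePi fun _ : ℕ => ν := by
  refine Measure.eq_infinitePi _ fun s t ht => ?_
  classical
  -- It is enough to treat the boxes over initial segments of `ℕ`, after filling up with `univ`.
  let t' : ℕ → Set G := fun i => if i ∈ s then t i else Set.univ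
  have ht' : ∀ i, MeasurableSet (t' i) := fun i => by
    by_cases h : i ∈ s <;> simp [t', h, ht]
  obtain ⟨n, hn⟩ : ∃ n, s ⊆ Finset.range (n + 1) := by
    obtain ⟨n, hn⟩ := s.exists_nat_subset_range
    exact ⟨n, hn.trans (Finset.range_mono (Nat.le_succ n))⟩
  have hset : Set.pi (s : Set ℕ) t = Set.pi (Finset.range (n + 1) : Set ℕ) t' := by
    ext x
    simp only [Set.mem_pi, Finset.mem_coe]
    refine ⟨fun h i _ => ?_, fun h i hi => ?_⟩
    · by_cases his : i ∈ s
      · simpa [t', his] using h i his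
      · simp [t', his]
    · simpa [t', hi] using h i (hn hi)
  have hprod : ∏ i ∈ s, ν (t i) = ∏ i ∈ Finset.range (n + 1), ν (t' i) := by
    rw [← Finset.prod_subset hn fun i _ hi => by simp [t', hi]]
    exact Finset.prod_congr rfl fun i hi => by simp [t', hi]
  have hpre : (fun q : G × (ℕ → G) => consSeq q.1 q.2) ⁻¹'
      Set.pi (Finset.range (n + 1) : Set ℕ) t' =
      t' 0 ×ˢ Set.pi (Finset.range n : Set ℕ) fun i => t' (i + 1) := by
    ext ⟨x, y⟩
    simp only [Set.mem_preimage, Set.mem_pi, Finset.mem_coe, Finset.mem_range, Set.mem_prod]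
    refine ⟨fun h => ⟨h 0 (Nat.succ_pos n), fun i hi => h (i + 1) (Nat.succ_lt_succ hi)⟩, ?_⟩
    rintro ⟨h0, h⟩ (_ | i) hi
    · exact h0
    · exact h i (Nat.lt_of_succ_lt_succ hi)
  rw [hset, hprod, Measure.map_apply measurable_consSeq
    (MeasurableSet.pi (Finset.countable_toSet _) fun i _ => ht' i), hpre, Measure.prod_prod,
    Measure.infinitePi_pi _ fun i _ => ht' (i + 1), Finset.prod_range_succ', mul_comm]

variable [Countable G] [MeasurableSingletonClass G]

theorem measurable_prepend : Measurable fun q : G × (ℕ → G) => prepend q.1 q.2 := by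
  refine measurable_pi_lambda _ fun n => ?_
  cases n with
  | zero => exact measurable_fst
  | succ n => exact measurable_fst.mul ((measurable_pi_apply n).comp measurable_snd)

theorem map_prepend_prod_pathLaw (ν : Measure G) [IsProbabilityMeasure ν] :
    (ν.prod (pathLaw ν)).map (fun q => prepend q.1 q.2) = pathLaw ν := by
  have h : ν.prod (pathLaw ν) =
      (ν.prod (Measure.infinitePi fun _ : ℕ => ν)).map (Prod.map id trajectory) := by
    rw [← Measure.map_prod_map _ _ measurable_id measurable_trajectory, Measure.map_id]
    rfl
  rw [h, Measure.map_map measurable_prepend (measurable_id.prodMap measurable_trajectory)]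
  conv_rhs => rw [pathLaw, ← map_consSeq_prod_infinitePi ν,
    Measure.map_map measurable_trajectory measurable_consSeq]
  congr 1
  funext q
  exact (trajectory_consSeq q.1 q.2).symm

/-- The harmonicity of `g ↦ P (g⁻¹ E)` at `1`, for a shift-invariant event `E`. -/
theorem pathLaw_eq_lintegral (ν : Measure G) [IsProbabilityMeasure ν] {E : Set (ℕ → G)}
    (hE : MeasurableSet[MeasurableSpace.invariants shift] E) :
    pathLaw ν E = ∫⁻ x, pathLaw ν {z | x • z ∈ E} ∂ν := by
  have hP := isProbabilityMeasure_pathLaw ν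
  rw [MeasurableSpace.measurableSet_invariants] at hE
  conv_lhs => rw [← map_prepend_prod_pathLaw ν]
  rw [Measure.map_apply measurable_prepend hE.1, Measure.prod_apply (measurable_prepend hE.1)]
  refine lintegral_congr fun x => ?_
  congr 1
  ext z
  exact (Set.ext_iff.1 hE.2 (prepend x z)).symm

/-- A shift-invariant property of almost every trajectory holds for all translates of almost every
trajectory: it passes to translates by the support of `ν`, and these generate the semigroup `G`. -/
theorem ae_forall_smul (ν : Measure G) [IsProbabilityMeasure ν] (hν : NonDegenerate ν)
    {Q : (ℕ → G) → Prop} (hQs : ∀ z, Q (shift z) ↔ Q z) (hQ : ∀ᵐ z ∂pathLaw ν, Q z) :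
    ∀ᵐ z ∂pathLaw ν, ∀ g : G, Q (g • z) := by
  have hP := isProbabilityMeasure_pathLaw ν
  have hstep : ∀ x : G, ν {x} ≠ 0 → ∀ R : (ℕ → G) → Prop, (∀ z, R (shift z) ↔ R z) →
      (∀ᵐ z ∂pathLaw ν, R z) → ∀ᵐ z ∂pathLaw ν, R (x • z) := by
    intro x hx R hRs hR
    rw [← map_prepend_prod_pathLaw ν] at hR
    have h := Measure.ae_ae_of_ae_prod (ae_of_ae_map measurable_prepend.aemeasurable hR)
    obtain ⟨y, hyx, hy⟩ : ∃ y, y = x ∧ ∀ᵐ z ∂pathLaw ν, R (prepend y z) := by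
      by_contra hcon
      exact hx (measure_mono_null (fun y hy hy' => hcon ⟨y, hy, hy'⟩) (ae_iff.1 h))
    rw [← hyx]
    filter_upwards [hy] with z hz
    rw [← shift_prepend]
    exact (hRs _).2 hz
  refine ae_all_iff.2 fun g => ?_
  have hg : g ∈ Subsemigroup.closure {g : G | ν {g} ≠ 0} := hν ▸ Subsemigroup.mem_top g
  have key : ∀ R : (ℕ → G) → Prop, (∀ z, R (shift z) ↔ R z) →
      (∀ᵐ z ∂pathLaw ν, R z) → ∀ᵐ z ∂pathLaw ν, R (g • z) := by
    induction hg using Subsemigroup.closure_induction with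
    | mem x hx => exact hstep x hx
    | mul a b _ _ iha ihb =>
      intro R hRs hR
      have := ihb (fun z => R (a • z)) (fun z => hRs (a • z)) (iha R hRs hR)
      simpa only [smul_smul] using this
  exact key Q hQs hQ

theorem eventually_atTop_succ {R : ℕ → Prop} :
    (∀ᶠ i in atTop, R (i + 1)) ↔ ∀ᶠ i in atTop, R i := by
  conv_rhs => rw [← map_add_atTop_eq_nat 1, eventually_map]

end Markov

/-! ### Prescribed increments occur infinitely often -/

section Returns

variable {G : Type*} [MeasurableSpace G]

/-- The filtration generated by the increments of the walk. -/
def incrementFiltration (G : Type*) [MeasurableSpace G] :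
    Filtration ℕ (MeasurableSpace.pi : MeasurableSpace (ℕ → G)) where
  seq n := ⨆ j ≤ n, MeasurableSpace.comap (fun x : ℕ → G => x j) inferInstance
  mono' _ _ hmn := biSup_mono fun _ hj => hj.trans hmn
  le' _ := iSup₂_le fun j _ => (measurable_pi_apply j).comap_le

theorem measurable_eval_incrementFiltration {j n : ℕ} (hj : j ≤ n) :
    Measurable[incrementFiltration G n] fun x : ℕ → G => x j :=
  measurable_iff_comap_le.2
    (le_iSup₂ (f := fun j (_ : j ≤ n) => MeasurableSpace.comap (fun x : ℕ → G => x j) _) j hj)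

theorem indep_comap_eval_incrementFiltration (ν : Measure G) [IsProbabilityMeasure ν] (n : ℕ) :
    Indep (MeasurableSpace.comap (fun x : ℕ → G => x (n + 1)) inferInstance)
      (incrementFiltration G n) (Measure.infinitePi fun _ : ℕ => ν) := by
  have hind : iIndepFun (fun (i : ℕ) (x : ℕ → G) => x i) (Measure.infinitePi fun _ : ℕ => ν) :=
    iIndepFun_infinitePi (X := fun _ x => x) fun _ => measurable_id
  have h := indep_iSup_of_disjoint (S := {n + 1}) (T := {k | k ≤ n})
    (fun k => (measurable_pi_apply (X := fun _ : ℕ => G) k).comap_le) hind (by simp)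
  rwa [iSup_singleton] at h

/-- If the past event `D i` occurs for infinitely many times `i`, then it is infinitely often
followed by the increment `y`. -/
theorem ae_frequently_and_eval_eq [MeasurableSingletonClass G] (ν : Measure G)
    [IsProbabilityMeasure ν] {y : G} (hy : ν {y} ≠ 0) {D : ℕ → Set (ℕ → G)}
    (hD : ∀ i, MeasurableSet[incrementFiltration G i] (D i)) :
    ∀ᵐ x ∂Measure.infinitePi fun _ : ℕ => ν,
      (∃ᶠ i in atTop, x ∈ D i) → ∃ᶠ i in atTop, x ∈ D i ∧ x (i + 1) = y := by
  set μ := Measure.infinitePi fun _ : ℕ => ν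
  let B : ℕ → Set (ℕ → G) := fun n => (fun x => x n) ⁻¹' {y}
  have hB : ∀ n, MeasurableSet (B n) := fun n =>
    measurable_pi_apply n (measurableSet_singleton y)
  let s : ℕ → Set (ℕ → G) := fun n => Nat.casesOn n ∅ fun k => D k ∩ B (k + 1)
  have hs : ∀ n, MeasurableSet[incrementFiltration G n] (s n) := by
    rintro (_ | k)
    · exact @MeasurableSet.empty _ (incrementFiltration G 0)
    · exact MeasurableSet.inter ((incrementFiltration G).mono (Nat.le_succ k) _ (hD k))
        (measurable_eval_incrementFiltration le_rfl (measurableSet_singleton y))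
  have hcond : ∀ k, μ[(s (k + 1)).indicator (1 : (ℕ → G) → ℝ) | incrementFiltration G k] =ᵐ[μ]
      (D k).indicator fun _ => ν.real {y} := by
    intro k
    have h1 : (s (k + 1)).indicator (1 : (ℕ → G) → ℝ) =
        (D k).indicator ((B (k + 1)).indicator 1) := (Set.indicator_indicator _ _ _).symm
    have h2 : μ[(B (k + 1)).indicator (1 : (ℕ → G) → ℝ) | incrementFiltration G k] =ᵐ[μ]
        fun _ => μ[(B (k + 1)).indicator (1 : (ℕ → G) → ℝ)] :=
      condExp_indep_eq (measurable_pi_apply (k + 1)).comap_le ((incrementFiltration G).le k)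
        (stronglyMeasurable_one.indicator ⟨{y}, measurableSet_singleton y, rfl⟩)
        (indep_comap_eval_incrementFiltration ν k)
    have h3 : μ[(B (k + 1)).indicator (1 : (ℕ → G) → ℝ)] = ν.real {y} := by
      rw [integral_indicator_one (hB _), measureReal_def, measureReal_def,
        ← Measure.infinitePi_map_eval (fun _ : ℕ => ν) (k + 1),
        Measure.map_apply (measurable_pi_apply _) (measurableSet_singleton y)]
    rw [h1]
    refine (condExp_indicator ((integrable_const (1 : ℝ)).indicator (hB _)) (hD k)).trans ?_
    filter_upwards [h2] with x hx
    by_cases hxD : x ∈ D k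
    · rw [Set.indicator_of_mem hxD, Set.indicator_of_mem hxD]
      exact hx.trans h3
    · rw [Set.indicator_of_notMem hxD, Set.indicator_of_notMem hxD]
  have hpos : 0 < ν.real {y} := ENNReal.toReal_pos hy (measure_ne_top ν _)
  filter_upwards [ae_mem_limsup_atTop_iff μ hs, ae_all_iff.2 hcond] with x hx hxc hfreq
  have h4 : x ∈ limsup D atTop := mem_limsup_iff_frequently_mem.2 hfreq
  rw [Set.limsup_eq_tendsto_sum_indicator_atTop hpos] at h4
  have h5 : x ∈ limsup s atTop := by
    rw [hx]
    simp only [hxc]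
    exact h4
  rw [← limsup_nat_add s 1] at h5
  exact mem_limsup_iff_frequently_mem.1 h5

variable [Group G] [Countable G] [MeasurableSingletonClass G]

theorem measurable_trajectory_incrementFiltration {j n : ℕ} (hj : j ≤ n) :
    Measurable[incrementFiltration G n] fun x : ℕ → G => trajectory x j := by
  induction j with
  | zero => exact measurable_eval_incrementFiltration hj
  | succ j ih =>
    exact (ih ((Nat.le_succ j).trans hj)).mul (measurable_eval_incrementFiltration hj)

/-- If the past event `D i` occurs for infinitely many times `i`, then it is infinitely often
followed by a block of increments with product `c`. -/
theorem ae_frequently_and_trajectory_add_eq (ν : Measure G) [IsProbabilityMeasure ν]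
    (hν : NonDegenerate ν) (c : G) :
    ∃ l, ∀ D : ℕ → Set (ℕ → G), (∀ i, MeasurableSet[incrementFiltration G i] (D i)) →
      ∀ᵐ x ∂Measure.infinitePi fun _ : ℕ => ν, (∃ᶠ i in atTop, x ∈ D i) →
        ∃ᶠ i in atTop, x ∈ D i ∧ trajectory x (i + l) = trajectory x i * c := by
  have hc : c ∈ Subsemigroup.closure {g : G | ν {g} ≠ 0} := hν ▸ Subsemigroup.mem_top c
  induction hc using Subsemigroup.closure_induction with
  | mem y hy =>
    refine ⟨1, fun D hD => ?_⟩
    filter_upwards [ae_frequently_and_eval_eq ν hy hD] with x hx hfreq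
    refine (hx hfreq).mono fun i hi => ⟨hi.1, ?_⟩
    rw [← hi.2]
    rfl
  | mul a b _ _ iha ihb =>
    obtain ⟨la, ha⟩ := iha
    obtain ⟨lb, hb⟩ := ihb
    refine ⟨la + lb, fun D hD => ?_⟩
    -- The event that `D` has occurred and that the increments since then have product `a`.
    let D' : ℕ → Set (ℕ → G) := fun j =>
      {x | la ≤ j ∧ x ∈ D (j - la) ∧ trajectory x j = trajectory x (j - la) * a}
    have hD' : ∀ j, MeasurableSet[incrementFiltration G j] (D' j) := by
      intro j
      refine MeasurableSet.inter (MeasurableSet.const _) (MeasurableSet.inter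
        ((incrementFiltration G).mono (Nat.sub_le j la) _ (hD _)) ?_)
      exact measurableSet_eq_fun (measurable_trajectory_incrementFiltration le_rfl)
        ((measurable_trajectory_incrementFiltration (Nat.sub_le j la)).mul_const a)
    filter_upwards [ha D hD, hb D' hD'] with x hxa hxb hfreq
    have h1 : ∃ᶠ j in atTop, x ∈ D' j := by
      rw [← map_add_atTop_eq_nat la, frequently_map]
      refine (hxa hfreq).mono fun i hi => ⟨Nat.le_add_left _ _, ?_⟩
      rwa [Nat.add_sub_cancel]
    have h2 := hxb h1
    rw [← map_add_atTop_eq_nat la, frequently_map] at h2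
    refine h2.mono fun i hi => ?_
    obtain ⟨⟨-, h3, h4⟩, h5⟩ := hi
    rw [Nat.add_sub_cancel] at h3 h4
    refine ⟨h3, ?_⟩
    rw [← add_assoc, h5, h4, mul_assoc]

/-- The condition `IsGoodPath.returns` holds almost surely. -/
theorem ae_returns (ν : Measure G) [IsProbabilityMeasure ν] (hν : NonDegenerate ν) :
    ∀ᵐ z ∂pathLaw ν, ∀ h c, (∃ᶠ i in atTop, (z i)⁻¹ * h * z i = c) →
      ∃ l, ∃ᶠ i in atTop, z (i + l) = h * z i := by
  refine ae_all_iff.2 fun h => ae_all_iff.2 fun c => ?_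
  obtain ⟨l, hl⟩ := ae_frequently_and_trajectory_add_eq ν hν c
  let A : ℕ → Set (ℕ → G) := fun i => {z | (z i)⁻¹ * h * z i = c}
  let B : ℕ → Set (ℕ → G) := fun i => {z | z (i + l) = h * z i}
  have hA : ∀ i, MeasurableSet (A i) := fun i =>
    (measurable_pi_apply (X := fun _ : ℕ => G) i)
      (MeasurableSet.of_discrete (s := {g : G | g⁻¹ * h * g = c}))
  have hB : ∀ i, MeasurableSet (B i) := fun i =>
    measurableSet_eq_fun (measurable_pi_apply _) 
      ((measurable_pi_apply (X := fun _ : ℕ => G) i).const_mul h)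
  have key : ∀ᵐ z ∂pathLaw ν, z ∈ (limsup A atTop)ᶜ ∪ limsup B atTop := by
    refine (ae_map_iff measurable_trajectory.aemeasurable
      ((MeasurableSet.measurableSet_limsup hA).compl.union
        (MeasurableSet.measurableSet_limsup hB))).2 ?_
    filter_upwards [hl (fun i => trajectory ⁻¹' A i) fun i =>
      measurable_trajectory_incrementFiltration le_rfl
        (MeasurableSet.of_discrete (s := {g : G | g⁻¹ * h * g = c}))] with x hx
    refine or_iff_not_imp_left.2 fun hxA => mem_limsup_iff_frequently_mem.2 ?_
    refine (hx (mem_limsup_iff_frequently_mem.1 (not_not.1 hxA) :)).mono fun i ⟨hi, hil⟩ => ?_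
    have hi : (trajectory x i)⁻¹ * h * trajectory x i = c := hi
    change trajectory x (i + l) = h * trajectory x i
    rw [hil, ← hi]
    group
  filter_upwards [key] with z hz hfreq
  have hzA : z ∈ limsup A atTop := mem_limsup_iff_frequently_mem.2 hfreq
  exact ⟨l, mem_limsup_iff_frequently_mem.1 (hz.resolve_left (not_not.2 hzA))⟩

end Returns

/-! ### Almost every trajectory is a good path -/

section Good

variable {G : Type*} [Group G] {W W' : ℕ+ → Set G} {p : G → G}

/-- The eventual value of the parent is an equivariant function of the trajectory. -/
theorem eventually_parent_smul_eq {z : ℕ → G} {h q : G} {n : ℕ}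
    (hW' : ∀ i, W' i ⊆ W i) (hW : ∀ i j, i ≠ j → W i ∩ W j = ∅)
    (h1 : ∀ g ∈ ⋃ i, W i, rank W (p g) < rank W g)
    (h2 : ∀ h : G, ∃ N : ℕ+, ∀ i > N, ∀ w ∈ W' i, h * w ∈ W i ∧ p (h * w) = h * p w)
    (hmem : ∀ᶠ i in atTop, ∃ j, z i ∈ W' j) (hunb : ∀ N, ∃ᶠ i in atTop, N < rank W (z i))
    (hn : IsRegularFrom W' p (h • z) n) (hq : ∀ᶠ i in atTop, p (z i) = q) :
    ∀ᶠ i in atTop, p ((h • z) i) = h * q := by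
  obtain ⟨N, hN⟩ := h2 h
  have hfreq : ∃ᶠ i in atTop, p ((h • z) i) = h * q := by
    refine ((hunb N).and_eventually (hmem.and hq)).mono fun i ⟨hi, ⟨j, hj⟩, hiq⟩ => ?_
    rw [rank_eq_of_mem hW (hW' j hj)] at hi
    rw [← hiq]
    exact (hN j ((PNat.coe_lt_coe _ _).1 hi) _ hj).2
  obtain ⟨i, hi, hin⟩ := (hfreq.and_eventually (eventually_ge_atTop n)).exists
  filter_upwards [eventually_ge_atTop i] with j hj
  obtain ⟨k, hk, hkj⟩ := (hfreq.and_eventually (eventually_ge_atTop j)).exists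
  have hij := hn.rank_parent_le hW' h1 hin hj
  rcases IsAncestor.eq_or_rank_lt h1 (hn.isAncestor_parent hW' (hin.trans hj) hkj) with h | h
  · rw [← h, hk]
  · rw [hk, ← hi] at h
    omega

theorem frequently_lt_of_not_bddAbove {u : ℕ → ℕ} (hu : ¬ BddAbove (Set.range u)) (N : ℕ) :
    ∃ᶠ i in atTop, N < u i := by
  intro h
  refine hu (IsBoundedUnder.bddAbove_range ⟨N, ?_⟩)
  rw [eventually_map]
  exact h.mono fun i hi => not_lt.1 hi

omit [Group G] in
theorem measurableSet_invariants_eventually [MeasurableSpace G] [Countable G]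
    [MeasurableSingletonClass G] (R : G → Prop) :
    MeasurableSet[MeasurableSpace.invariants shift] {z : ℕ → G | ∀ᶠ i in atTop, R (z i)} := by
  rw [MeasurableSpace.measurableSet_invariants]
  constructor
  · have h : MeasurableSet (liminf (fun i : ℕ => {z : ℕ → G | R (z i)}) atTop) :=
      MeasurableSet.measurableSet_liminf fun i =>
        measurable_pi_apply (X := fun _ : ℕ => G) i (MeasurableSet.of_discrete (s := {g | R g}))
    have hset : {z : ℕ → G | ∀ᶠ i in atTop, R (z i)} =
        liminf (fun i : ℕ => {z : ℕ → G | R (z i)}) atTop := by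
      ext z
      rw [mem_liminf_iff_eventually_mem]
      rfl
    rwa [hset]
  · ext z
    exact eventually_atTop_succ (R := fun i => R (z i))

variable [Countable G] [MeasurableSpace G] [MeasurableSingletonClass G]

/-- The parents of the points of a trajectory almost surely do not stabilize. Otherwise the law of
the limit would be a nonzero finite measure on `G` whose largest value is, by stationarity, attained
everywhere, so that `G` would be finite. -/
theorem ae_parent_not_eventually_const (ν : Measure G) [IsProbabilityMeasure ν]
    (hν : NonDegenerate ν) (hW' : ∀ i, W' i ⊆ W i) (hW : ∀ i j, i ≠ j → W i ∩ W j = ∅)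
    (h1 : ∀ g ∈ ⋃ i, W i, rank W (p g) < rank W g)
    (h2 : ∀ h : G, ∃ N : ℕ+, ∀ i > N, ∀ w ∈ W' i, h * w ∈ W i ∧ p (h * w) = h * p w)
    (h3 : ∀ᵐ z ∂pathLaw ν, ∀ᶠ i in atTop, ∃ j, z i ∈ W' j)
    (h4 : ∀ᵐ z ∂pathLaw ν, ∀ᶠ i in atTop, p (z (i + 1)) = p (z i) ∨ p (z (i + 1)) = z i)
    (h5 : ∀ᵐ z ∂pathLaw ν, ¬ BddAbove (Set.range fun i => rank W (z i))) :
    ∀ᵐ z ∂pathLaw ν, ∀ q, ¬ ∀ᶠ i in atTop, p (z i) = q := by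
  have hP := isProbabilityMeasure_pathLaw ν
  refine ae_all_iff.2 fun q₀ => ?_
  let E : G → Set (ℕ → G) := fun q => {z | ∀ᶠ i in atTop, p (z i) = q}
  have hE : ∀ q, MeasurableSet[MeasurableSpace.invariants shift] (E q) := fun q =>
    measurableSet_invariants_eventually fun g => p g = q
  have hEm : ∀ q, MeasurableSet (E q) := fun q => MeasurableSpace.invariants_le _ _ (hE q)
  have hEd : Pairwise (Function.onFun Disjoint E) := fun a b hab =>
    Set.disjoint_left.2 fun z ha hb => by
      obtain ⟨i, hia, hib⟩ := (Eventually.and ha hb).exists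
      exact hab (hia.symm.trans hib)
  by_contra hcon
  have hpos : 0 < pathLaw ν (E q₀) := pos_iff_ne_zero.2 fun h => hcon (by
    rw [ae_iff]
    simpa only [not_not] using h)
  have hfin : {q | pathLaw ν (E q₀) ≤ pathLaw ν (E q)}.Finite :=
    Measure.finite_const_le_meas_of_disjoint_iUnion _ hpos hEm hEd (measure_ne_top _ _)
  obtain ⟨a, ha, hmax⟩ := Set.exists_max_image _ (fun q => pathLaw ν (E q)) hfin
    ⟨q₀, le_refl (pathLaw ν (E q₀))⟩
  have hle : ∀ q, pathLaw ν (E q) ≤ pathLaw ν (E a) := fun q => by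
    rcases le_total (pathLaw ν (E q₀)) (pathLaw ν (E q)) with h | h
    · exact hmax q h
    · exact h.trans ha
  have hgood : ∀ᵐ z ∂pathLaw ν, ∀ g : G, (∀ᶠ i in atTop, ∃ j, (g • z) i ∈ W' j) ∧
      (∀ᶠ i in atTop, p ((g • z) (i + 1)) = p ((g • z) i) ∨ p ((g • z) (i + 1)) = (g • z) i) ∧
      ∀ N, ∃ᶠ i in atTop, N < rank W ((g • z) i) := by
    refine ae_forall_smul ν hν (Q := fun z => (∀ᶠ i in atTop, ∃ j, z i ∈ W' j) ∧
      (∀ᶠ i in atTop, p (z (i + 1)) = p (z i) ∨ p (z (i + 1)) = z i) ∧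
      ∀ N, ∃ᶠ i in atTop, N < rank W (z i)) (fun z => ?_) ?_
    · refine and_congr (eventually_atTop_succ (R := fun i => ∃ j, z i ∈ W' j)) (and_congr
        (eventually_atTop_succ (R := fun i => p (z (i + 1)) = p (z i) ∨ p (z (i + 1)) = z i))
        (forall_congr' fun N => not_congr ?_))
      exact eventually_atTop_succ (R := fun i => ¬ N < rank W (z i))
    · filter_upwards [h3, h4, h5] with z hz3 hz4 hz5
      exact ⟨hz3, hz4, frequently_lt_of_not_bddAbove hz5⟩
  have hsub : ∀ (x b : G), pathLaw ν {z | x • z ∈ E b} ≤ pathLaw ν (E (x⁻¹ * b)) := by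
    intro x b
    refine measure_mono_ae ?_
    filter_upwards [hgood] with z hz hzE
    obtain ⟨n, hn⟩ : ∃ n, IsRegularFrom W' p (x⁻¹ • x • z) n := by
      rw [inv_smul_smul, ← one_smul G z]
      exact eventually_atTop.1 ((hz 1).1.and (hz 1).2.1)
    have := eventually_parent_smul_eq hW' hW h1 h2 (hz x).1 (hz x).2.2 hn hzE
    rwa [inv_smul_smul] at this
  have hstep : ∀ x : G, ν {x} ≠ 0 → ∀ b, pathLaw ν (E b) = pathLaw ν (E a) →
      pathLaw ν (E (x⁻¹ * b)) = pathLaw ν (E a) := by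
    intro x hx b hb
    have hint : ∫⁻ y, pathLaw ν (E (y⁻¹ * b)) ∂ν ≤ pathLaw ν (E a) :=
      (lintegral_mono fun y => hle _).trans (by simp)
    have hae : (fun y => pathLaw ν (E (y⁻¹ * b))) =ᵐ[ν] fun _ => pathLaw ν (E a) := by
      refine ae_eq_of_ae_le_of_lintegral_le (Eventually.of_forall fun y => hle _)
        (ne_top_of_le_ne_top (measure_ne_top _ _) hint) aemeasurable_const ?_
      rw [lintegral_const, measure_univ, mul_one, ← hb, pathLaw_eq_lintegral ν (hE b)]
      exact lintegral_mono fun y => hsub y b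
    by_contra hne
    exact hx (measure_mono_null (Set.singleton_subset_iff.2 hne) (ae_iff.1 hae))
  have hall : ∀ g b : G, pathLaw ν (E b) = pathLaw ν (E a) →
      pathLaw ν (E (g⁻¹ * b)) = pathLaw ν (E a) := by
    intro g
    have hg : g ∈ Subsemigroup.closure {g : G | ν {g} ≠ 0} := hν ▸ Subsemigroup.mem_top g
    induction hg using Subsemigroup.closure_induction with
    | mem x hx => exact hstep x hx
    | mul x y _ _ ihx ihy =>
      intro b hb
      rw [mul_inv_rev, mul_assoc]
      exact ihy _ (ihx b hb)
  have hG : (Set.univ : Set G).Finite := hfin.subset fun b _ => by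
    have := hall (a * b⁻¹) a rfl
    rw [mul_inv_rev, inv_inv, inv_mul_cancel_right] at this
    exact ha.trans this.ge
  obtain ⟨z, hz⟩ := h5.exists
  refine hz ((hG.image (rank W)).subset ?_).bddAbove
  rintro _ ⟨i, rfl⟩
  exact ⟨z i, Set.mem_univ _, rfl⟩

/-- A nontrivial element of the group almost surely changes the limit ray of the trajectory. -/
theorem ae_limitRay_smul_ne (ν : Measure G) [IsProbabilityMeasure ν]
    (hν : NonDegenerate ν) (hW' : ∀ i, W' i ⊆ W i) (hW : ∀ i j, i ≠ j → W i ∩ W j = ∅)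
    (h1 : ∀ g ∈ ⋃ i, W i, rank W (p g) < rank W g)
    (h2 : ∀ h : G, ∃ N : ℕ+, ∀ i > N, ∀ w ∈ W' i, h * w ∈ W i ∧ p (h * w) = h * p w)
    (h3 : ∀ᵐ z ∂pathLaw ν, ∀ᶠ i in atTop, ∃ j, z i ∈ W' j)
    (h4 : ∀ᵐ z ∂pathLaw ν, ∀ᶠ i in atTop, p (z (i + 1)) = p (z i) ∨ p (z (i + 1)) = z i)
    (h5 : ∀ᵐ z ∂pathLaw ν, ¬ BddAbove (Set.range fun i => rank W (z i))) :
    ∀ᵐ z ∂pathLaw ν, ∀ g : G, g ≠ 1 → limitRay W p z ≠ limitRay W p (g • z) := by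
  have hgood : ∀ᵐ z ∂pathLaw ν, ∀ g : G, IsGoodPath W W' p (g • z) := by
    refine ae_forall_smul ν hν (fun z => ?_) ?_
    · have e1 := eventually_atTop_succ (R := fun i => ∃ j, z i ∈ W' j)
      have e2 := eventually_atTop_succ
        (R := fun i => p (z (i + 1)) = p (z i) ∨ p (z (i + 1)) = z i)
      have e3 := fun q => eventually_atTop_succ (R := fun i => p (z i) = q)
      have e4 := fun h c => not_congr
        (eventually_atTop_succ (R := fun i => ¬ (z i)⁻¹ * h * z i = c))
      have e5 := fun h l => not_congr
        (eventually_atTop_succ (R := fun i => ¬ z (i + l) = h * z i))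
      have e6 : ∀ i l, shift z (i + l) = z (i + 1 + l) := fun i l =>
        congrArg z (Nat.add_right_comm i l 1)
      refine ⟨fun h => ⟨e1.1 h.mem, e2.1 h.step,
        fun q hq => h.parent_not_eventually_const q ((e3 q).2 hq), fun g c hc => ?_⟩,
        fun h => ⟨e1.2 h.mem, e2.2 h.step,
        fun q hq => h.parent_not_eventually_const q ((e3 q).1 hq), fun g c hc => ?_⟩⟩
      · obtain ⟨l, hl⟩ := h.returns g c ((e4 g c).2 hc)
        simp only [e6] at hl
        exact ⟨l, (e5 g l).1 hl⟩
      · obtain ⟨l, hl⟩ := h.returns g c ((e4 g c).1 hc)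
        refine ⟨l, ?_⟩
        simp only [e6]
        exact (e5 g l).2 hl
    · filter_upwards [h3, h4, ae_returns ν hν,
        ae_parent_not_eventually_const ν hν hW' hW h1 h2 h3 h4 h5] with z hz3 hz4 hzr hzc
      exact ⟨hz3, hz4, hzc, hzr⟩
  filter_upwards [hgood] with z hz g hg hray
  have hz1 := hz 1
  rw [one_smul] at hz1
  exact hg (hz1.eq_one_of_limitRay_smul_eq (hz g) hray hW' hW h1 h2)

end Good

end GroupWalk

theorem mainTheorem3 {G : Type*} [Group G] [Countable G] [MeasurableSpace G]
    [MeasurableSingletonClass G] (ν : Measure G) [IsProbabilityMeasure ν]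
    (hν : GroupWalk.NonDegenerate ν)
    (W W' : ℕ+ → Set G) (p : G → G)
    (hW' : ∀ i, W' i ⊆ W i)
    (hW : ∀ i j, i ≠ j → W i ∩ W j = ∅)
    (h1 : ∀ g ∈ ⋃ i, W i, GroupWalk.rank W (p g) < GroupWalk.rank W g)
    (h2 : ∀ h : G, ∃ N : ℕ+, ∀ i > N, ∀ w ∈ W' i, h * w ∈ W i ∧ p (h * w) = h * p w)
    (h3 : ∀ᵐ z ∂GroupWalk.pathLaw ν, ∃ i₀ : ℕ, ∀ i > i₀, ∃ j, z i ∈ W' j)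
    (h4 : ∀ᵐ z ∂GroupWalk.pathLaw ν, ∃ i₀ : ℕ, ∀ i > i₀,
      p (z (i + 1)) = p (z i) ∨ p (z (i + 1)) = z i)
    (h5 : ∀ᵐ z ∂GroupWalk.pathLaw ν, ¬ BddAbove (Set.range fun i => GroupWalk.rank W (z i))) :
    ¬ GroupWalk.TrivialBoundary ν ∧
      ∀ {B : Type*} [MeasurableSpace B] [StandardBorelSpace B] [MulAction G B]
        (bnd : (ℕ → G) → B), GroupWalk.IsPoissonBoundary ν bnd →
        GroupWalk.EssentiallyFree G ((GroupWalk.pathLaw ν).map bnd) := by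
  have hP := GroupWalk.isProbabilityMeasure_pathLaw ν
  have hev : ∀ R : ℕ → Prop, (∃ i₀ : ℕ, ∀ i > i₀, R i) → ∀ᶠ i in Filter.atTop, R i :=
    fun R ⟨i₀, h⟩ => (Filter.eventually_gt_atTop i₀).mono h
  have hne := GroupWalk.ae_limitRay_smul_ne ν hν hW' hW h1 h2
    (h3.mono fun z => hev _) (h4.mono fun z => hev _) h5
  have hinv : ∀ a : G, MeasurableSet[MeasurableSpace.invariants GroupWalk.shift]
      {z : ℕ → G | a ∈ GroupWalk.limitRay W p z} := fun a =>
    GroupWalk.measurableSet_invariants_eventually fun g => GroupWalk.IsAncestor W p g a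
  have hshift : ∀ (a : G) (z : ℕ → G),
      a ∈ GroupWalk.limitRay W p (GroupWalk.shift z) ↔ a ∈ GroupWalk.limitRay W p z :=
    fun a z => Set.ext_iff.1 (MeasurableSpace.measurableSet_invariants.1 (hinv a)).2 z
  constructor
  · intro htriv
    -- If the boundary is trivial, almost every trajectory and all its translates have the same
    -- limit ray.
    have hconst : ∀ᵐ z ∂GroupWalk.pathLaw ν, ∀ g a : G, a ∈ GroupWalk.limitRay W p (g • z) ↔
        GroupWalk.pathLaw ν {z | a ∈ GroupWalk.limitRay W p z} = 1 := by
      refine GroupWalk.ae_forall_smul ν hν (Q := fun z => ∀ a : G, a ∈ GroupWalk.limitRay W p z ↔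
        GroupWalk.pathLaw ν {z | a ∈ GroupWalk.limitRay W p z} = 1)
        (fun z => forall_congr' fun a => by rw [hshift]) (ae_all_iff.2 fun a => ?_)
      rcases htriv _ (hinv a) with h | h
      · filter_upwards [measure_eq_zero_iff_ae_notMem.1 h] with z hz
        exact iff_of_false hz (by simp [h])
      · filter_upwards [(prob_compl_eq_zero_iff (MeasurableSpace.invariants_le _ _ (hinv a))).2 h
          |> measure_eq_zero_iff_ae_notMem.1] with z hz
        exact iff_of_true (not_not.1 hz) h
    obtain ⟨z, hz, hzc, hz5⟩ := (hne.and (hconst.and h5)).exists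
    -- Some group element is nontrivial, since the ranks are unbounded.
    obtain ⟨g, hg⟩ : ∃ g : G, g ≠ 1 := by
      by_contra! hG
      refine hz5 ⟨GroupWalk.rank W 1, ?_⟩
      rintro _ ⟨i, rfl⟩
      change GroupWalk.rank W (z i) ≤ _
      rw [hG (z i)]
    refine hz g hg (Set.ext fun a => ?_)
    have h1a := hzc 1 a
    rw [one_smul] at h1a
    rw [h1a, hzc g a]
  · intro B _ _ _ bnd hbnd g hg
    have hmeas : Measurable bnd := hbnd.measurable_bnd.mono (MeasurableSpace.invariants_le _) le_rfl
    have hfixed : MeasurableSet {b : B | g • b = b} :=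
      measurableSet_eq_fun (hbnd.measurable_smul g) measurable_id
    rw [Measure.map_apply hmeas hfixed]
    choose S hSm hS using fun a => hbnd.generates _ (hinv a)
    have hcomp : ∀ z, bnd (GroupWalk.shift z) = bnd z :=
      congrFun (MeasurableSpace.comp_eq_of_measurable_invariants hbnd.measurable_bnd)
    -- The limit ray is a function of the point of the boundary.
    have hray : ∀ᵐ z ∂GroupWalk.pathLaw ν, ∀ g a : G,
        a ∈ GroupWalk.limitRay W p (g • z) ↔ bnd (g • z) ∈ S a := by
      refine GroupWalk.ae_forall_smul ν hν
        (Q := fun z => ∀ a : G, a ∈ GroupWalk.limitRay W p z ↔ bnd z ∈ S a)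
        (fun z => forall_congr' fun a => by rw [hshift, hcomp]) (ae_all_iff.2 fun a => ?_)
      filter_upwards [hS a] with z hz
      exact iff_of_eq hz
    rw [measure_eq_zero_iff_ae_notMem]
    filter_upwards [hne, hray, hbnd.equivariant g] with z hz hzr hze hfix
    refine hz g hg (Set.ext fun a => ?_)
    have hfix : g • bnd z = bnd z := hfix
    have h1a := hzr 1 a
    rw [one_smul] at h1a
    rw [h1a, hzr g a, hze, hfix]
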